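/- Let $\kappa$ be a regular uncountable cardinal and let $\lambda$ be a singular cardinal such that $\operatorname{cf}(\lambda)\ge\kappa$ and $\tau^{\operatorname{cf}(\lambda)}<\lambda$ for every cardinal $\tau<\lambda$. Let $P_\kappa(\lambda)=\{a\subseteq\lambda:|a|<\kappa\}$. An \emph{ideal} on $P_\kappa(\lambda)$ is a collection $J$ of subsets of $P_\kappa(\lambda)$ such that (i) $J$ contains every noncofinal set, that is, every $A\subseteq P_\kappa(\lambda)$ for which some $b\in P_\kappa(\lambda)$ is included in no member of $A$; (ii) $P_\kappa(\lambda)\notin J$; (iii) $J$ is closed under subsets; (iv) $J$ is closed under unions of fewer than $\kappa$ of its members. Put $J^+=\{A\subseteq P_\kappa(\lambda):A\notin J\}$, $J^*=\{A\subseteq P_\kappa(\lambda):P_\kappa(\lambda)\setminus A\in J\}$ and, for $A\in J^+$, $J|A=\{B\subseteq P_\kappa(\lambda):B\cap A\in J\}$. For a cardinal $\mu\le\lambda$, $J$ is \emph{$\mu$-normal} if for every $A\in J^+$ and every $f:A\to\mu$ with $f(a)\in a$ for all $a\in A$ there is $B\in J^+$ with $B\subseteq A$ on which $f$ is constant. Let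 $NS^{\mu}_{\kappa,\lambda}$ be the smallest $\mu$-normal ideal on $P_\kappa(\lambda)$, and let $NS_{\kappa,\lambda}$ be the nonstationary ideal, that is, the collection of all subsets of $P_\kappa(\lambda)$ disjoint from some closed unbounded $C\subseteq P_\kappa(\lambda)$ (every $b\in P_\kappa(\lambda)$ is included in a member of $C$, and the union of every nonempty $\subseteq$-chain of fewer than $\kappa$ members of $C$ is in $C$). Let $\mathcal M_J$ be the collection of all $Q\subseteq J^+$ such that $A\cap B\in J$ for any distinct $A,B\in Q$ and such that for every $C\in J^+$ there is $A\in Q$ with $A\cap C\in J^+$. The ideal $J$ is \emph{precipitous} if for every $A\in J^+$ and every sequence $\langle Q_n:n<\omega\rangle$ of members of $\mathcal M_{J|A}$ such that every member of $Q_{n+1}$ is included in a member of $Q_n$, for all $n<\omega$, there are $X_n\in Q_n$ $(n<\omega)$ with $X_0\supseteq X_1\supseteq\cdots$ and $\bigcap_{n<\omega}X_n\ne\emptyset$. The ideal $J$ is \emph{nowhere precipitous} if $J|A$ is not precipitous for every $A\in J^+$. Then there exists $B\in NS_{\kappa,\lambda}^*$ such that $NS^{\operatorname{cf}(\lambda)}_{\kappa,\lambda}|B$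 is (an ideal on $P_\kappa(\lambda)$ that is) nowhere precipitous. -/

import Mathlib

universe u

open Cardinal

namespace PKappa

/-- `P_κ(λ)`: the subsets of `λ` of cardinality less than `κ`, the cardinal `λ` being realised as
the canonical well-ordered set of order type `λ.ord` (the ordinals below `λ`). -/
abbrev Pk (κ lam : Cardinal.{u}) : Type u :=
  {a : Set lam.ord.ToType // #a < κ}

/-- The ordinal represented by an element of `λ`. -/
noncomputable def toOrd {lam : Cardinal.{u}} (x : lam.ord.ToType) : Ordinal.{u} :=
  (Ordinal.ToType.mk.symm x : Ordinal.{u})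

/-- `I_{κ,λ}`: the noncofinal subsets of `P_κ(λ)`. -/
def noncofinal (κ lam : Cardinal.{u}) : Set (Set (Pk κ lam)) :=
  {A | ∃ b : Pk κ lam, ∀ a ∈ A, ¬ b.1 ⊆ a.1}

/-- Ideals on `P_κ(λ)`: proper, `κ`-complete, and containing every noncofinal set. -/
structure IsIdeal {κ lam : Cardinal.{u}} (J : Set (Set (Pk κ lam))) : Prop where
  noncofinal_subset : noncofinal κ lam ⊆ J
  univ_notMem : Set.univ ∉ J
  mem_of_subset : ∀ A ∈ J, ∀ B ⊆ A, B ∈ J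
  sUnion_mem : ∀ X ⊆ J, #X < κ → ⋃₀ X ∈ J

/-- `J^+`. -/
def positive {κ lam : Cardinal.{u}} (J : Set (Set (Pk κ lam))) : Set (Set (Pk κ lam)) :=
  {A | A ∉ J}

/-- `J^*`, the filter dual to `J`. -/
def dualFilter {κ lam : Cardinal.{u}} (J : Set (Set (Pk κ lam))) : Set (Set (Pk κ lam)) :=
  {A | Aᶜ ∈ J}

/-- The restriction `J | A`. -/
def restrict {κ lam : Cardinal.{u}} (J : Set (Set (Pk κ lam))) (A : Set (Pk κ lam)) :
    Set (Set (Pk κ lam)) :=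
  {B | B ∩ A ∈ J}

/-- `μ`-normality: every regressive function with values in `μ` on a `J`-positive set is constant
on a `J`-positive subset. -/
def IsNormal {κ lam : Cardinal.{u}} (μ : Cardinal.{u}) (J : Set (Set (Pk κ lam))) : Prop :=
  ∀ A ∈ positive J, ∀ f : Pk κ lam → lam.ord.ToType,
    (∀ a ∈ A, f a ∈ a.1 ∧ toOrd (f a) < μ.ord) →
      ∃ B ∈ positive J, B ⊆ A ∧ ∃ c, ∀ a ∈ B, f a = c

/-- `NS^μ_{κ,λ}`: the smallest `μ`-normal ideal on `P_κ(λ)`, as the intersection of all of them. -/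
def NSmu (κ lam μ : Cardinal.{u}) : Set (Set (Pk κ lam)) :=
  ⋂₀ {J | IsIdeal J ∧ IsNormal μ J}

/-- Closed unbounded subsets of `P_κ(λ)`: cofinal, and closed under unions of nonempty
`⊆`-chains of fewer than `κ` members (such unions have cardinality `< κ` for `κ` regular). -/
structure IsClub {κ lam : Cardinal.{u}} (C : Set (Pk κ lam)) : Prop where
  unbounded : ∀ b : Pk κ lam, ∃ a ∈ C, b.1 ⊆ a.1
  closed : ∀ D ⊆ C, D.Nonempty → IsChain (fun a b : Pk κ lam => a.1 ⊆ b.1) D → #D < κ →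
    ∀ c : Pk κ lam, c.1 = ⋃ a ∈ D, a.1 → c ∈ C

/-- `NS_{κ,λ}`: the nonstationary subsets of `P_κ(λ)`, those disjoint from some club. -/
def NS (κ lam : Cardinal.{u}) : Set (Set (Pk κ lam)) :=
  {A | ∃ C : Set (Pk κ lam), IsClub C ∧ A ∩ C = ∅}

/-- `M_J`: the maximal `J`-almost disjoint families of `J`-positive sets. -/
def maxAntichains {κ lam : Cardinal.{u}} (J : Set (Set (Pk κ lam))) :
    Set (Set (Set (Pk κ lam))) :=
  {Q | Q ⊆ positive J ∧ (∀ A ∈ Q, ∀ B ∈ Q, A ≠ B → A ∩ B ∈ J) ∧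
    ∀ C ∈ positive J, ∃ A ∈ Q, A ∩ C ∈ positive J}

/-- Precipitousness, through refining sequences of maximal almost disjoint families. -/
def Precipitous {κ lam : Cardinal.{u}} (J : Set (Set (Pk κ lam))) : Prop :=
  ∀ A ∈ positive J, ∀ Q : ℕ → Set (Set (Pk κ lam)),
    (∀ n, Q n ∈ maxAntichains (restrict J A)) →
    (∀ n, ∀ B' ∈ Q (n + 1), ∃ B ∈ Q n, B' ⊆ B) →
      ∃ f : ℕ → Set (Pk κ lam), (∀ n, f n ∈ Q n) ∧ (∀ n, f (n + 1) ⊆ f n) ∧ (⋂ n, f n).Nonempty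

/-- `J` is an ideal on `P_κ(λ)` no restriction of which to a positive set is precipitous. -/
def NowherePrecipitous {κ lam : Cardinal.{u}} (J : Set (Set (Pk κ lam))) : Prop :=
  IsIdeal J ∧ ∀ A ∈ positive J, ¬ Precipitous (restrict J A)

end PKappa

/-!
Let `M` be the well-order of type `cf λ`, viewed as the initial segment of `λ`. The ideal
`NS^{cf λ}_{κ,λ}` is dual to the filter generated by the sets of all `a` meeting `M` and closed
under some `f : M → M → P_κ(λ)`. Fix `r : λ → M` whose initial segments `{x | r x ≤ k}` have sizes
strictly between `2 ^ cf λ` and `λ`, and restrict to the club of those `a` for which the values of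
`r` on `a` are exceeded in `a ∩ M`; sort these `a` into fibers by the least strict upper bound `d`
of `a ∩ M`. Inside the fiber of `d`, closure under `f` depends only on the trace of `f` on
`{x | r x < d}`.

The key point is that every positive set meets some fiber in at least as many points as there are
traces at `d`. Otherwise, as each `a` in the fiber of `d` can guess only `2 ^ |a| ≤ 2 ^ cf λ`
traces, there is for every `d` a function `f d` whose trace at `d` is guessed by no such `a`. But
since `τ ^ cf λ < λ` for `τ < λ`, the truncations of the family `f` can be coded by elements of `λ`,
and any `a` closed under the map taking `k ∈ M` to the code of the `k`-th truncation guesses the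
trace of `f d`.

So from a positive set `W` one can select distinct points of `W`, one in each closure set of each
fiber in which `W` is large. Label the point selected for a trace by the rank of that trace in a
well-order of minimal type. The labels can be kept strictly below any function `F` on `W` whose
initial segments are small on each fiber, and they are again such a function on the positive set
of selected points. Iterating yields refining maximal antichains labelled by pointwise decreasing
ordinal functions, so no decreasing sequence of their members has a common point.
-/

namespace PKappa

section Selection

theorem exists_injective_selector {I β : Type u} {Θ : Cardinal.{u}} (hI : #I ≤ Θ)
    (S : I → Set β) (hS : ∀ i, Θ ≤ #(S i)) :
    ∃ a : I → β, Function.Injective a ∧ ∀ i, a i ∈ S i := by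
  obtain ⟨_, _, hord⟩ := exists_ord_eq_type_lt I
  have exists_new : ∀ i (g : ∀ j, j < i → β), ∃ b ∈ S i, ∀ j h, g j h ≠ b := by
    intro i g
    have hcard : #(Set.range fun j : Set.Iio i => g j.1 j.2) < #(S i) :=
      (mk_range_le.trans_lt (mk_Iio_lt i hord)).trans_le (hI.trans (hS i))
    obtain ⟨b, hb, hnew⟩ := Set.not_subset.1 fun h => (mk_le_mk_of_subset h).not_gt hcard
    exact ⟨b, hb, fun j h e => hnew ⟨⟨j, h⟩, e⟩⟩
  choose pick pick_mem pick_new using exists_new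
  let a : I → β := wellFounded_lt.fix pick
  have ha : ∀ i, a i = pick i fun j _ => a j := fun i => wellFounded_lt.fix_eq pick i
  have ne_of_lt : ∀ i j, j < i → a j ≠ a i := fun i j h => by
    rw [ha i]
    exact pick_new i (fun j _ => a j) j h
  refine ⟨a, fun i j hij => ?_, fun i => ha i ▸ pick_mem i _⟩
  by_contra hne
  exact (lt_or_gt_of_ne hne).elim (fun h => ne_of_lt j i h hij) fun h => ne_of_lt i j h hij.symm

theorem exists_rank_mk_le_lt (T : Type u) [Infinite T] :
    ∃ rank : T → Ordinal.{u}, ∀ v, #{w | rank w ≤ rank v} < #T := by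
  obtain ⟨_, _, hord⟩ := exists_ord_eq_type_lt T
  refine ⟨Ordinal.typein (· < ·), fun v => ?_⟩
  simpa only [Ordinal.typein_le_typein, not_lt, Set.Iic_def] using
    mk_Iic_lt v hord (aleph0_le_mk T)

end Selection

section Precipitous

variable {κ lam : Cardinal.{u}} {J : Set (Set (Pk κ lam))}

theorem IsIdeal.isLowerSet (hJ : IsIdeal J) : IsLowerSet J := fun A B hBA hA =>
  hJ.mem_of_subset A hA B hBA

theorem IsIdeal.restrict (hJ : IsIdeal J) {A : Set (Pk κ lam)} (hA : A ∉ J) :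
    IsIdeal (restrict J A) where
  noncofinal_subset B hB := hJ.isLowerSet Set.inter_subset_left (hJ.noncofinal_subset hB)
  univ_notMem h := hA (by simpa only [PKappa.restrict, Set.mem_ofPred_eq, Set.univ_inter] using h)
  mem_of_subset _ hB _ hCB := hJ.isLowerSet (Set.inter_subset_inter_left A hCB) hB
  sUnion_mem X hX hcard := by
    have himage : ⋃₀ X ∩ A = ⋃₀ ((· ∩ A) '' X) := by
      rw [Set.sUnion_image, Set.sUnion_eq_biUnion, Set.iUnion₂_inter]
    change ⋃₀ X ∩ A ∈ J
    rw [himage]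
    exact hJ.sUnion_mem _ (Set.image_subset_iff.2 hX) (mk_image_le.trans_lt hcard)

theorem restrict_univ (J : Set (Set (Pk κ lam))) : restrict J Set.univ = J := by
  simp only [restrict, Set.inter_univ, Set.ofPred_mem_eq]

theorem singleton_univ_mem_maxAntichains (huniv : Set.univ ∉ J) :
    {Set.univ} ∈ maxAntichains J := by
  refine ⟨Set.singleton_subset_iff.2 huniv, ?_, fun C hC => ⟨Set.univ, rfl, ?_⟩⟩
  · rintro A rfl B rfl hne
    exact (hne rfl).elim
  · rwa [Set.univ_inter]

theorem exists_maxAntichains_subset (hJ : IsLowerSet J) {D : Set (Set (Pk κ lam))}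
    (hD : D ⊆ positive J) (hdense : ∀ C ∈ positive J, ∃ X ∈ D, X ⊆ C) :
    ∃ Q ⊆ D, Q ∈ maxAntichains J := by
  obtain ⟨Q, hQ⟩ := zorn_subset
    {Q : Set (Set (Pk κ lam)) | Q ⊆ D ∧ Q.Pairwise fun A B => A ∩ B ∈ J} fun c hc hchain =>
      ⟨⋃₀ c, ⟨Set.sUnion_subset fun s hs => (hc hs).1,
        (Set.pairwise_sUnion hchain.directedOn).2 fun s hs => (hc hs).2⟩,
        fun s hs => Set.subset_sUnion_of_mem hs⟩
  refine ⟨Q, hQ.prop.1, hQ.prop.1.trans hD, fun A hA B hB h => hQ.prop.2 hA hB h, fun C hC => ?_⟩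
  obtain ⟨X, hXD, hXC⟩ := hdense C hC
  by_contra! hdisj
  have hX : ∀ A ∈ Q, A ∩ X ∈ J := fun A hA =>
    hJ (Set.inter_subset_inter_right A hXC) (not_not.1 (hdisj A hA))
  have hXQ : X ∈ Q := hQ.le_of_ge
    ⟨Set.insert_subset hXD hQ.prop.1,
      hQ.prop.2.insert fun A hA _ => ⟨Set.inter_comm A X ▸ hX A hA, hX A hA⟩⟩
    (Set.subset_insert X Q) (Set.mem_insert X Q)
  exact hD hXD (Set.inter_self X ▸ hX X hXQ)

/-- A maximal almost disjoint family each of whose members `X` is labelled by an ordinal-valued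
function `F` with `Φ X F`. -/
structure LabelledAntichain (J : Set (Set (Pk κ lam)))
    (Φ : Set (Pk κ lam) → (Pk κ lam → Ordinal.{u}) → Prop) where
  sets : Set (Set (Pk κ lam))
  label : Set (Pk κ lam) → Pk κ lam → Ordinal.{u}
  sets_mem : sets ∈ maxAntichains J
  label_spec : ∀ X ∈ sets, Φ X (label X)

variable {Φ : Set (Pk κ lam) → (Pk κ lam → Ordinal.{u}) → Prop}

/-- The family `s` refines `t`, with pointwise smaller labels. -/
def LabelledAntichain.Descends (s t : LabelledAntichain J Φ) : Prop :=
  ∀ X ∈ s.sets, ∃ Y ∈ t.sets, X ⊆ Y ∧ ∀ a ∈ X, s.label X a < t.label Y a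

theorem LabelledAntichain.exists_descends (hJ : IsLowerSet J)
    (hΦ : ∀ {W W' F}, W' ⊆ W → Φ W F → Φ W' F)
    (hstep : ∀ W ∉ J, ∀ F, Φ W F → ∃ W' ∉ J, W' ⊆ W ∧ ∃ F', Φ W' F' ∧ ∀ a ∈ W', F' a < F a)
    (t : LabelledAntichain J Φ) : ∃ s : LabelledAntichain J Φ, s.Descends t := by
  let D := {X | X ∈ positive J ∧
    ∃ F, Φ X F ∧ ∃ Y ∈ t.sets, X ⊆ Y ∧ ∀ a ∈ X, F a < t.label Y a}
  have hdense : ∀ C ∈ positive J, ∃ X ∈ D, X ⊆ C := by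
    intro C hC
    obtain ⟨Y, hY, hYC⟩ := t.sets_mem.2.2 C hC
    obtain ⟨X, hX, hXY, F, hF, hlt⟩ := hstep _ hYC (t.label Y)
      (hΦ Set.inter_subset_left (t.label_spec Y hY))
    exact ⟨X, ⟨hX, F, hF, Y, hY, hXY.trans Set.inter_subset_left, hlt⟩,
      hXY.trans Set.inter_subset_right⟩
  obtain ⟨Q, hQD, hQ⟩ := exists_maxAntichains_subset hJ (fun X hX => hX.1) hdense
  choose! F hF hlt using fun X (hX : X ∈ Q) => (hQD hX).2
  exact ⟨⟨Q, F, hQ, hF⟩, hlt⟩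

theorem LabelledAntichain.not_precipitous (hJ : IsLowerSet J) (huniv : Set.univ ∉ J)
    (s : ℕ → LabelledAntichain J Φ) (hs : ∀ n, (s (n + 1)).Descends (s n)) :
    ¬ Precipitous J := by
  intro hprec
  obtain ⟨X, hX, hanti, a, ha⟩ := hprec Set.univ huniv (fun n => (s n).sets)
    (fun n => (restrict_univ J).symm ▸ (s n).sets_mem)
    fun n Z hZ => (hs n Z hZ).imp fun Y hY => ⟨hY.1, hY.2.1⟩
  refine not_strictAnti_of_wellFoundedLT (fun n => (s n).label (X n) a)
    (strictAnti_nat_of_succ_lt fun n => ?_)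
  obtain ⟨Y, hY, hXY, hlt⟩ := hs n _ (hX (n + 1))
  obtain rfl : X n = Y := by
    by_contra hne
    exact (s (n + 1)).sets_mem.1 (hX (n + 1))
      (hJ (Set.subset_inter (hanti n) hXY) ((s n).sets_mem.2.1 _ (hX n) _ hY hne))
  exact hlt a (Set.mem_iInter.1 ha (n + 1))

theorem not_precipitous_of_descent (hJ : IsLowerSet J) (huniv : Set.univ ∉ J)
    (hΦ : ∀ {W W' F}, W' ⊆ W → Φ W F → Φ W' F) (hstart : ∃ F, Φ Set.univ F)
    (hstep : ∀ W ∉ J, ∀ F, Φ W F → ∃ W' ∉ J, W' ⊆ W ∧ ∃ F', Φ W' F' ∧ ∀ a ∈ W', F' a < F a) :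
    ¬ Precipitous J := by
  obtain ⟨F, hF⟩ := hstart
  choose next hnext using LabelledAntichain.exists_descends (Φ := Φ) hJ hΦ hstep
  let s₀ : LabelledAntichain J Φ :=
    ⟨{Set.univ}, fun _ => F, singleton_univ_mem_maxAntichains huniv, by rintro X rfl; exact hF⟩
  refine LabelledAntichain.not_precipitous hJ huniv (fun n => next^[n] s₀) fun n => ?_
  rw [Function.iterate_succ_apply']
  exact hnext _

end Precipitous

section ThickBase

variable {X D : Type u} {T : D → Type u} {J : Set (Set X)} {C : ∀ d, T d → Set X}
  {rank : ∀ d, T d → Ordinal.{u}} {W W' : Set X} {F : X → Ordinal.{u}}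

/-- A family of sets, indexed by the `T d`, such that those with different `d` are disjoint and,
for every positive `W`, each member of the filter dual to `J` includes some `C d v` that meets `W`
in at least as many points as `T d` has elements. -/
structure IsThickBase (J : Set (Set X)) (C : ∀ d, T d → Set X) : Prop where
  disjoint : ∀ {d d'}, d ≠ d' → ∀ v v', Disjoint (C d v) (C d' v')
  exists_thick : ∀ W ∉ J, ∀ A ∈ J, ∃ d v, Disjoint (C d v) A ∧ #(T d) ≤ #(W ∩ C d v : Set X)

/-- On each `W ∩ ⋃ v, C d v`, the initial segments of `F` up to the ranks of elements of `T d` have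
fewer points than `T d`. -/
def HasSmallSegments (C : ∀ d, T d → Set X) (rank : ∀ d, T d → Ordinal.{u}) (W : Set X)
    (F : X → Ordinal.{u}) : Prop :=
  ∀ d v, #{a | a ∈ W ∩ ⋃ w, C d w ∧ F a ≤ rank d v} < #(T d)

theorem HasSmallSegments.mono (hW : W' ⊆ W) (h : HasSmallSegments C rank W F) :
    HasSmallSegments C rank W' F := fun d v =>
  (mk_le_mk_of_subset (t := {a | a ∈ W ∩ ⋃ w, C d w ∧ F a ≤ rank d v})
    fun _ ha => ⟨⟨hW ha.1.1, ha.1.2⟩, ha.2⟩).trans_lt (h d v)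

theorem exists_hasSmallSegments_univ (C : ∀ d, T d → Set X) (rank : ∀ d, T d → Ordinal.{u}) :
    ∃ F, HasSmallSegments C rank Set.univ F := by
  refine ⟨fun _ => ⨆ q : Σ d, T d, Order.succ (rank q.1 q.2), fun d v => ?_⟩
  have hlt : rank d v < ⨆ q : Σ d, T d, Order.succ (rank q.1 q.2) :=
    (Order.lt_succ _).trans_le (Ordinal.le_iSup (fun q : Σ d, T d => _) ⟨d, v⟩)
  simpa only [hlt.not_ge, and_false, Set.ofPred_false, mk_eq_zero] using
    pos_iff_ne_zero.2 (mk_ne_zero_iff.2 ⟨v⟩)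

theorem HasSmallSegments.le_mk_inter_lt {d : D} [Infinite (T d)]
    (h : HasSmallSegments C rank W F) {v : T d} (hv : #(T d) ≤ #(W ∩ C d v : Set X)) :
    #(T d) ≤ #{a | a ∈ W ∩ C d v ∧ rank d v < F a} := by
  by_contra! hlt
  have hsub : W ∩ C d v ⊆ {a | a ∈ W ∩ C d v ∧ rank d v < F a} ∪
      {a | a ∈ W ∩ ⋃ w, C d w ∧ F a ≤ rank d v} := fun a ha =>
    (lt_or_ge (rank d v) (F a)).imp (fun h => ⟨ha, h⟩)
      fun h => ⟨⟨ha.1, Set.mem_iUnion_of_mem v ha.2⟩, h⟩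
  exact ((hv.trans (mk_le_mk_of_subset hsub)).trans (mk_union_le _ _)).not_gt
    (add_lt_of_lt (aleph0_le_mk _) hlt (h d v))

theorem HasSmallSegments.exists_selector [∀ d, Infinite (T d)]
    (hC : ∀ {d d'}, d ≠ d' → ∀ v v', Disjoint (C d v) (C d' v'))
    (h : HasSmallSegments C rank W F) :
    ∃ a : (Σ d, {v : T d // #(T d) ≤ #(W ∩ C d v : Set X)}) → X, Function.Injective a ∧
      ∀ q, a q ∈ W ∩ C q.1 q.2.1 ∧ rank q.1 q.2.1 < F (a q) := by
  choose a ha hmem using fun d => exists_injective_selector (mk_subtype_le _)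
    (fun v : {v : T d // #(T d) ≤ #(W ∩ C d v : Set X)} =>
      {a | a ∈ W ∩ C d v.1 ∧ rank d v.1 < F a}) fun v => h.le_mk_inter_lt v.2
  refine ⟨fun q => a q.1 q.2, ?_, fun q => hmem q.1 q.2⟩
  rintro ⟨d, v⟩ ⟨d', v'⟩ (heq : a d v = a d' v')
  obtain rfl : d = d' := by
    by_contra hne
    exact Set.disjoint_left.1 (hC hne v.1 v'.1) (hmem d v).1.2 (heq ▸ (hmem d' v').1.2)
  rw [ha d heq]

theorem IsThickBase.exists_hasSmallSegments_lt [∀ d, Infinite (T d)] (hC : IsThickBase J C)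
    (hrank : ∀ d v, #{w | rank d w ≤ rank d v} < #(T d)) (hW : W ∉ J)
    (hF : HasSmallSegments C rank W F) :
    ∃ W' ∉ J, W' ⊆ W ∧ ∃ F', HasSmallSegments C rank W' F' ∧ ∀ a ∈ W', F' a < F a := by
  obtain ⟨a, ha, hmem⟩ := hF.exists_selector hC.disjoint
  let F' : X → Ordinal.{u} := Function.extend a (fun q => rank q.1 q.2.1) 0
  have hF' : ∀ q, F' (a q) = rank q.1 q.2.1 := ha.extend_apply _ _
  refine ⟨Set.range a, fun hJ => ?_, Set.range_subset_iff.2 fun q => (hmem q).1.1, F',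
    fun d v => ?_, Set.forall_mem_range.2 fun q => hF' q ▸ (hmem q).2⟩
  · obtain ⟨d, v, hdisj, hv⟩ := hC.exists_thick W hW _ hJ
    exact Set.disjoint_left.1 hdisj (hmem ⟨d, v, hv⟩).1.2 ⟨_, rfl⟩
  · have hsub : {x | x ∈ Set.range a ∩ ⋃ w, C d w ∧ F' x ≤ rank d v} ⊆
        (fun w => a ⟨d, w⟩) '' {w | rank d w.1 ≤ rank d v} := by
      rintro _ ⟨⟨⟨⟨d', w⟩, rfl⟩, hd⟩, hle⟩
      obtain ⟨w', hw'⟩ := Set.mem_iUnion.1 hd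
      obtain rfl : d' = d := by
        by_contra hne
        exact Set.disjoint_left.1 (hC.disjoint hne w.1 w') (hmem ⟨d', w⟩).1.2 hw'
      exact ⟨w, (hF' ⟨d', w⟩).ge.trans hle, rfl⟩
    exact ((mk_le_mk_of_subset hsub).trans mk_image_le).trans_lt
      ((mk_preimage_of_injective _ {w | rank d w ≤ rank d v} Subtype.val_injective).trans_lt
        (hrank d v))

end ThickBase

section NowherePrecipitous

variable {κ lam : Cardinal.{u}} {J : Set (Set (Pk κ lam))} {D : Type u} {T : D → Type u}
  {C : ∀ d, T d → Set (Pk κ lam)}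

theorem IsThickBase.restrict (hC : IsThickBase J C) (A : Set (Pk κ lam)) :
    IsThickBase (restrict J A) fun d v => C d v ∩ A where
  disjoint hne v v' :=
    (hC.disjoint hne v v').mono Set.inter_subset_left Set.inter_subset_left
  exists_thick W hW B hB := by
    obtain ⟨d, v, hdisj, hcard⟩ := hC.exists_thick (W ∩ A) hW (B ∩ A) hB
    refine ⟨d, v, ?_, ?_⟩
    · rw [Set.disjoint_left] at hdisj ⊢
      exact fun a ha hB => hdisj ha.1 ⟨hB, ha.2⟩
    · rwa [Set.inter_assoc, Set.inter_comm A] at hcard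

theorem IsThickBase.not_precipitous [∀ d, Infinite (T d)] (hC : IsThickBase J C)
    (hJ : IsLowerSet J) (huniv : Set.univ ∉ J) : ¬ Precipitous J := by
  choose rank hrank using fun d => exists_rank_mk_le_lt (T d)
  exact not_precipitous_of_descent (Φ := HasSmallSegments C rank) hJ huniv
    HasSmallSegments.mono (exists_hasSmallSegments_univ C rank)
    fun W hW F hF => hC.exists_hasSmallSegments_lt hrank hW hF

theorem IsIdeal.nowherePrecipitous [∀ d, Infinite (T d)] (hJ : IsIdeal J)
    (hC : IsThickBase J C) : NowherePrecipitous J :=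
  ⟨hJ, fun A hA => (hC.restrict A).not_precipitous (hJ.restrict hA).isLowerSet
    (hJ.restrict hA).univ_notMem⟩

end NowherePrecipitous

section ClosureIdeal

variable {κ lam : Cardinal.{u}}

/-- The union of fewer than `κ` members of `P_κ(λ)`, as a member of `P_κ(λ)`. -/
def iUnionPk (hκ : κ.IsRegular) {I : Type u} (hI : #I < κ) (g : I → Pk κ lam) : Pk κ lam :=
  ⟨⋃ i, (g i).1, (card_iUnion_lt_iff_forall_of_isRegular hκ hI).2 fun i => (g i).2⟩

theorem subset_iUnionPk (hκ : κ.IsRegular) {I : Type u} (hI : #I < κ) (g : I → Pk κ lam) (i : I) :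
    (g i).1 ⊆ (iUnionPk hκ hI g).1 :=
  Set.subset_iUnion (fun i => (g i).1) i

/-- The union of two members of `P_κ(λ)`, as a member of `P_κ(λ)`. -/
def unionPk (hκ : κ.IsRegular) (a b : Pk κ lam) : Pk κ lam :=
  ⟨a.1 ∪ b.1, (mk_union_le _ _).trans_lt (add_lt_of_lt hκ.aleph0_le a.2 b.2)⟩

/-- A singleton as a member of `P_κ(λ)`. -/
def singletonPk (hκ : κ.IsRegular) (x : lam.ord.ToType) : Pk κ lam :=
  ⟨{x}, by simpa using one_lt_aleph0.trans_le hκ.aleph0_le⟩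

theorem exists_superset_closed (hκ : κ.IsRegular) (hunc : ℵ₀ < κ)
    (F : lam.ord.ToType → lam.ord.ToType → Pk κ lam) (b : Pk κ lam) :
    ∃ a : Pk κ lam, b.1 ⊆ a.1 ∧ ∀ x ∈ a.1, ∀ y ∈ a.1, (F x y).1 ⊆ a.1 := by
  have hprod : ∀ c : Pk κ lam, #(c.1 × c.1) < κ := fun c => by
    rw [mk_prod, lift_id]
    exact mul_lt_of_lt hκ.aleph0_le c.2 c.2
  let step : Pk κ lam → Pk κ lam := fun c =>
    unionPk hκ c (iUnionPk hκ (hprod c) fun p => F p.1 p.2)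
  have subset_step : ∀ c : Pk κ lam, ∀ x ∈ c.1, ∀ y ∈ c.1, (F x y).1 ⊆ (step c).1 :=
    fun c x hx y hy =>
      (subset_iUnionPk hκ (hprod c) (fun p => F p.1 p.2) ⟨⟨x, hx⟩, ⟨y, hy⟩⟩).trans
        Set.subset_union_right
  let s : ℕ → Pk κ lam := fun n => step^[n] b
  have hs : ∀ n, s (n + 1) = step (s n) := fun n => Function.iterate_succ_apply' step n b
  have hmono : Monotone fun n => (s n).1 :=
    monotone_nat_of_le_succ fun n => hs n ▸ Set.subset_union_left
  have hℕ : #(ULift.{u} ℕ) < κ := by simpa using hunc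
  have hsub : ∀ n, (s n).1 ⊆ (iUnionPk hκ hℕ fun n => s n.down).1 := fun n =>
    subset_iUnionPk hκ hℕ (fun n => s n.down) ⟨n⟩
  refine ⟨iUnionPk hκ hℕ fun n => s n.down, hsub 0, fun x hx y hy => ?_⟩
  obtain ⟨⟨m⟩, hm⟩ := Set.mem_iUnion.1 hx
  obtain ⟨⟨n⟩, hn⟩ := Set.mem_iUnion.1 hy
  exact (subset_step (s (max m n)) x (hmono (le_max_left m n) hm) y
    (hmono (le_max_right m n) hn)).trans (hs (max m n) ▸ hsub (max m n + 1))

theorem IsIdeal.union_mem {J : Set (Set (Pk κ lam))} (hJ : IsIdeal J) (hκ : κ.IsRegular)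
    {A B : Set (Pk κ lam)} (hA : A ∈ J) (hB : B ∈ J) : A ∪ B ∈ J := by
  rw [← Set.sUnion_pair]
  exact hJ.sUnion_mem _ (Set.pair_subset hA hB)
    ((lt_aleph0_iff_set_finite.2 (Set.toFinite _)).trans_le hκ.aleph0_le)

variable {M : Type u} {ι : M ↪ lam.ord.ToType}

/-- The elements of `P_κ(λ)` that meet the copy of `M` in `λ` and are closed under a binary
set-valued function on it. -/
def closedUnder (ι : M ↪ lam.ord.ToType) (f : M → M → Pk κ lam) : Set (Pk κ lam) :=
  {a | (ι ⁻¹' a.1).Nonempty ∧ ∀ i ∈ ι ⁻¹' a.1, ∀ j ∈ ι ⁻¹' a.1, (f i j).1 ⊆ a.1}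

/-- The ideal dual to the filter generated by the sets `closedUnder ι f`. -/
def closureIdeal (κ : Cardinal.{u}) (ι : M ↪ lam.ord.ToType) : Set (Set (Pk κ lam)) :=
  {W | ∃ f : M → M → Pk κ lam, Disjoint W (closedUnder ι f)}

theorem closedUnder_union (hκ : κ.IsRegular) (f g : M → M → Pk κ lam) :
    closedUnder ι (fun i j => unionPk hκ (f i j) (g i j)) =
      closedUnder ι f ∩ closedUnder ι g := by
  ext a
  simp only [closedUnder, unionPk, Set.union_subset_iff, Set.mem_inter_iff, Set.mem_ofPred_eq,
    forall_and, ← and_and_left]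

theorem closedUnder_iUnion_subset (hκ : κ.IsRegular) {I : Type u} (hI : #I < κ)
    (f : I → M → M → Pk κ lam) (c : I) :
    closedUnder ι (fun i j => iUnionPk hκ hI fun c => f c i j) ⊆ closedUnder ι (f c) :=
  fun _ ha => ⟨ha.1, fun i hi j hj =>
    (subset_iUnionPk hκ hI (fun c => f c i j) c).trans (ha.2 i hi j hj)⟩

theorem inter_closedUnder_notMem (hκ : κ.IsRegular) {W : Set (Pk κ lam)}
    (hW : W ∉ closureIdeal κ ι) (f : M → M → Pk κ lam) :
    W ∩ closedUnder ι f ∉ closureIdeal κ ι := by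
  rintro ⟨g, hg⟩
  refine hW ⟨fun i j => unionPk hκ (f i j) (g i j), ?_⟩
  rwa [closedUnder_union, Set.disjoint_iff_inter_eq_empty, ← Set.inter_assoc,
    ← Set.disjoint_iff_inter_eq_empty]

theorem exists_mem_closedUnder [Nonempty M] (hκ : κ.IsRegular) (hunc : ℵ₀ < κ)
    (f : M → M → Pk κ lam) (g : lam.ord.ToType → lam.ord.ToType) (b : Pk κ lam) :
    ∃ a ∈ closedUnder ι f, b.1 ⊆ a.1 ∧ ∀ x ∈ a.1, g x ∈ a.1 := by
  obtain ⟨i₀⟩ := ‹Nonempty M›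
  have hinv : ∀ i, Function.invFun ι (ι i) = i := Function.leftInverse_invFun ι.injective
  obtain ⟨a, hba, ha⟩ := exists_superset_closed hκ hunc
    (fun x y => unionPk hκ (f (Function.invFun ι x) (Function.invFun ι y)) (singletonPk hκ (g x)))
    (unionPk hκ b (singletonPk hκ (ι i₀)))
  refine ⟨a, ⟨⟨i₀, hba (Or.inr rfl)⟩, fun i hi j hj => ?_⟩, Set.subset_union_left.trans hba,
    fun x hx => ha x hx x hx (Or.inr rfl)⟩
  have hij := Set.subset_union_left.trans (ha _ hi _ hj)
  rwa [hinv, hinv] at hij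

theorem isIdeal_closureIdeal [Nonempty M] (hκ : κ.IsRegular) (hunc : ℵ₀ < κ) :
    IsIdeal (closureIdeal κ ι) where
  noncofinal_subset := fun A ⟨b, hb⟩ =>
    ⟨fun _ _ => b, Set.disjoint_left.2 fun a haA ⟨⟨i, hi⟩, ha⟩ => hb a haA (ha i hi i hi)⟩
  univ_notMem := fun ⟨f, hf⟩ => by
    obtain ⟨i₀⟩ := ‹Nonempty M›
    obtain ⟨a, ha, -⟩ := exists_mem_closedUnder (ι := ι) hκ hunc f id (f i₀ i₀)
    exact Set.disjoint_left.1 hf (Set.mem_univ a) ha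
  mem_of_subset := fun A ⟨f, hf⟩ B hB => ⟨f, hf.mono_left hB⟩
  sUnion_mem := fun X hX hcard => by
    choose f hf using fun W : X => hX W.2
    exact ⟨_, Set.disjoint_sUnion_left.2 fun W hW =>
      (hf ⟨W, hW⟩).mono_right (closedUnder_iUnion_subset hκ hcard f ⟨W, hW⟩)⟩

theorem isNormal_closureIdeal [Infinite M] (hκ : κ.IsRegular) {μ : Cardinal.{u}}
    (hμ : ∀ x, toOrd x < μ.ord → x ∈ Set.range ι) : IsNormal μ (closureIdeal κ ι) := by
  intro A hA p hp
  by_contra! hcon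
  have hlevel : ∀ c : M, {a | a ∈ A ∧ p a = ι c} ∈ closureIdeal κ ι := fun c => by
    by_contra hc
    obtain ⟨a, ha, hne⟩ := hcon _ hc (fun a ha => ha.1) (ι c)
    exact hne ha.2
  choose f hf using hlevel
  obtain ⟨e⟩ : Nonempty (M × M ≃ M) := by
    rw [← Cardinal.eq, mk_prod, lift_id, mul_eq_self (aleph0_le_mk M)]
  -- Closure under a pairing of `M` turns the ternary function `(c, i, j) ↦ f c i j` into a
  -- binary one.
  refine hA ⟨fun i j => unionPk hκ (singletonPk hκ (ι (e (i, j))))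
    (f (e.symm i).1 (e.symm i).2 j), Set.disjoint_left.2 fun a haA ha => ?_⟩
  obtain ⟨c, hc⟩ := hμ _ (hp a haA).2
  have hca : c ∈ ι ⁻¹' a.1 := by
    rw [Set.mem_preimage, hc]
    exact (hp a haA).1
  have hpair : ∀ i ∈ ι ⁻¹' a.1, e (c, i) ∈ ι ⁻¹' a.1 := fun i hi =>
    ha.2 c hca i hi (Or.inl rfl)
  refine Set.disjoint_left.1 (hf c) ⟨haA, hc.symm⟩ ⟨ha.1, fun i hi j hj => ?_⟩
  have hsub := Set.subset_union_right.trans (ha.2 _ (hpair i hi) j hj)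
  rwa [e.symm_apply_apply] at hsub

theorem compl_closedUnder_mem [Nonempty M] (hκ : κ.IsRegular) {μ : Cardinal.{u}}
    (hμ : ∀ i, toOrd (ι i) < μ.ord) {J : Set (Set (Pk κ lam))} (hJ : IsIdeal J)
    (hn : IsNormal μ J) (f : M → M → Pk κ lam) : (closedUnder ι f)ᶜ ∈ J := by
  obtain ⟨i₀⟩ := ‹Nonempty M›
  let N : Set (Pk κ lam) := {a | ∃ q : M × M, ι q.1 ∈ a.1 ∧ ι q.2 ∈ a.1 ∧ ¬ (f q.1 q.2).1 ⊆ a.1}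
  suffices hN : N ∈ J by
    have hE : {a : Pk κ lam | ¬ (ι ⁻¹' a.1).Nonempty} ∈ J := hJ.noncofinal_subset
      ⟨singletonPk hκ (ι i₀), fun a ha h => ha ⟨i₀, h rfl⟩⟩
    refine hJ.isLowerSet (fun a ha => ?_) (hJ.union_mem hκ hE hN)
    refine or_iff_not_imp_left.2 fun hne => ?_
    by_contra hcl
    exact ha ⟨not_not.1 hne, fun i hi j hj => not_not.1 fun h => hcl ⟨(i, j), hi, hj, h⟩⟩
  by_contra hpos
  choose! q hq₁ hq₂ hq using fun a (ha : a ∈ N) => ha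
  obtain ⟨B, hB, hBN, c, hc⟩ := hn N hpos (fun a => ι (q a).1) fun a ha => ⟨hq₁ a ha, hμ _⟩
  obtain ⟨B', hB', hBB', c', hc'⟩ := hn B hB (fun a => ι (q a).2)
    fun a ha => ⟨hq₂ a (hBN ha), hμ _⟩
  have hconst : ∀ a ∈ B', ∀ b ∈ B', q a = q b := fun a ha b hb =>
    Prod.ext (ι.injective ((hc a (hBB' ha)).trans (hc b (hBB' hb)).symm))
      (ι.injective ((hc' a ha).trans (hc' b hb).symm))
  refine hB' (hJ.noncofinal_subset ?_)
  obtain rfl | ⟨b, hb⟩ := B'.eq_empty_or_nonempty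
  · exact ⟨f i₀ i₀, fun a ha => ha.elim⟩
  · exact ⟨f (q b).1 (q b).2, fun a ha => hconst a ha b hb ▸ hq a (hBN (hBB' ha))⟩

theorem NSmu_eq_closureIdeal [Infinite M] (hκ : κ.IsRegular) (hunc : ℵ₀ < κ) {μ : Cardinal.{u}}
    (hμ : ∀ x, toOrd x < μ.ord ↔ x ∈ Set.range ι) : NSmu κ lam μ = closureIdeal κ ι := by
  refine Set.Subset.antisymm (Set.sInter_subset_of_mem
    ⟨isIdeal_closureIdeal hκ hunc, isNormal_closureIdeal hκ fun x => (hμ x).1⟩) ?_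
  rintro W ⟨f, hf⟩ J ⟨hJ, hn⟩
  exact hJ.isLowerSet hf.subset_compl_right
    (compl_closedUnder_mem hκ (fun i => (hμ _).2 ⟨i, rfl⟩) hJ hn f)

end ClosureIdeal

section Dominating

variable {κ lam : Cardinal.{u}} {M : Type u} [LinearOrder M] {ι : M ↪ lam.ord.ToType}
  {r : lam.ord.ToType → M}

/-- The elements `a` of `P_κ(λ)` meeting the copy of `M` in `λ` in a nonempty set on which the
values of `r` on `a` are exceeded. -/
def dominating (κ : Cardinal.{u}) (ι : M ↪ lam.ord.ToType) (r : lam.ord.ToType → M) :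
    Set (Pk κ lam) :=
  {a | (ι ⁻¹' a.1).Nonempty ∧ ∀ x ∈ a.1, ∃ i ∈ ι ⁻¹' a.1, r x < i}

theorem exists_mem_dominating_closedUnder [Nonempty M] [NoMaxOrder M] (hκ : κ.IsRegular)
    (hunc : ℵ₀ < κ) (f : M → M → Pk κ lam) (b : Pk κ lam) :
    ∃ a ∈ dominating κ ι r, a ∈ closedUnder ι f ∧ b.1 ⊆ a.1 := by
  choose g hg using fun x => exists_gt (r x)
  obtain ⟨a, ha, hba, hga⟩ := exists_mem_closedUnder (ι := ι) hκ hunc f (fun x => ι (g x)) b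
  exact ⟨a, ⟨ha.1, fun x hx => ⟨g x, hga x hx, hg x⟩⟩, ha, hba⟩

theorem isClub_dominating [Nonempty M] [NoMaxOrder M] (hκ : κ.IsRegular) (hunc : ℵ₀ < κ) :
    IsClub (dominating κ ι r) where
  unbounded b := by
    obtain ⟨a, ha, -, hba⟩ :=
      exists_mem_dominating_closedUnder (ι := ι) (r := r) hκ hunc (fun _ _ => b) b
    exact ⟨a, ha, hba⟩
  closed := by
    rintro D hD ⟨a, ha⟩ - - c hc
    have hsub : ∀ b ∈ D, b.1 ⊆ c.1 := fun b hb =>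
      hc ▸ Set.subset_biUnion_of_mem (u := fun b : Pk κ lam => b.1) hb
    refine ⟨(hD ha).1.mono (Set.preimage_mono (hsub a ha)), fun x hx => ?_⟩
    rw [hc] at hx
    obtain ⟨b, hb, hxb⟩ := Set.mem_iUnion₂.1 hx
    exact ((hD hb).2 x hxb).imp fun i hi => ⟨hsub b hb hi.1, hi.2⟩

theorem dominating_mem_dualFilter [Nonempty M] [NoMaxOrder M] (hκ : κ.IsRegular) (hunc : ℵ₀ < κ) :
    dominating κ ι r ∈ dualFilter (NS κ lam) :=
  ⟨_, isClub_dominating hκ hunc, Set.compl_inter_self _⟩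

theorem dominating_notMem_closureIdeal [Nonempty M] [NoMaxOrder M] (hκ : κ.IsRegular)
    (hunc : ℵ₀ < κ) : dominating κ ι r ∉ closureIdeal κ ι := by
  rintro ⟨f, hf⟩
  obtain ⟨a, ha, hfa, -⟩ := exists_mem_dominating_closedUnder (ι := ι) (r := r) hκ hunc f
    ⟨∅, by simpa using hκ.pos⟩
  exact Set.disjoint_left.1 hf ha hfa

/-- The elements `a` of `dominating κ ι r` such that `d` is the least strict upper bound of the
part of `M` in `a`. -/
def fiber (κ : Cardinal.{u}) (ι : M ↪ lam.ord.ToType) (r : lam.ord.ToType → M) (d : M) :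
    Set (Pk κ lam) :=
  {a | a ∈ dominating κ ι r ∧ IsLeast {e | ∀ i ∈ ι ⁻¹' a.1, i < e} d}

theorem disjoint_fiber {d d' : M} (hne : d ≠ d') :
    Disjoint (fiber κ ι r d) (fiber κ ι r d') :=
  Set.disjoint_left.2 fun _ h h' => hne (h.2.unique h'.2)

theorem exists_mem_fiber [WellFoundedLT M] (hcof : κ ≤ Order.cof M) {a : Pk κ lam}
    (ha : a ∈ dominating κ ι r) : ∃ d, a ∈ fiber κ ι r d := by
  have hcard : #(ι ⁻¹' a.1) < Order.cof M :=
    (mk_preimage_of_injective ι a.1 ι.injective).trans_lt (a.2.trans_le hcof)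
  have hbdd : {e | ∀ i ∈ ι ⁻¹' a.1, i < e}.Nonempty :=
    not_isCofinal_iff.1 fun h => (Order.cof_le h).not_gt hcard
  exact ⟨_, ha, wellFounded_lt.min_mem _ hbdd, fun _ => wellFounded_lt.min_le⟩

theorem exists_lt_of_mem_fiber {a : Pk κ lam} {d : M} (h : a ∈ fiber κ ι r d) : ∃ k, k < d :=
  h.1.1.imp h.2.1

theorem subset_preimage_Iio_of_mem_fiber {a : Pk κ lam} {d : M} (h : a ∈ fiber κ ι r d) :
    a.1 ⊆ r ⁻¹' Set.Iio d := fun x hx =>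
  let ⟨i, hi, hlt⟩ := h.1.2 x hx
  hlt.trans (h.2.1 i hi)

theorem exists_le_of_mem_fiber {a : Pk κ lam} {d : M} (h : a ∈ fiber κ ι r d) {k : M}
    (hk : k < d) : ∃ i ∈ ι ⁻¹' a.1, k ≤ i := by
  by_contra! hlt
  exact hk.not_ge (h.2.2 hlt)

end Dominating

section Trace

variable {κ lam : Cardinal.{u}} {M : Type u} [LinearOrder M] {ι : M ↪ lam.ord.ToType}
  {r : lam.ord.ToType → M} {a : Pk κ lam} {d : M}

/-- The part of `f` that decides which elements of `fiber κ ι r d` are closed under `f`: the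
intersection of each value with `{x | r x < d}`, and whether it is all of the value. -/
def trace (r : lam.ord.ToType → M) (d : M) (f : M → M → Pk κ lam) :
    M → M → Set lam.ord.ToType × Prop :=
  fun i j => ((f i j).1 ∩ r ⁻¹' Set.Iio d, (f i j).1 ⊆ r ⁻¹' Set.Iio d)

/-- The possible traces at `d`. -/
def traces (κ : Cardinal.{u}) (r : lam.ord.ToType → M) (d : M) :
    Set (M → M → Set lam.ord.ToType × Prop) :=
  Set.range (trace (κ := κ) r d)

/-- The closure condition expressed by a trace `t`; on `fiber κ ι r d`, closure under the functions
with trace `t` at `d`. -/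
def closedUnderTrace (κ : Cardinal.{u}) (ι : M ↪ lam.ord.ToType)
    (t : M → M → Set lam.ord.ToType × Prop) : Set (Pk κ lam) :=
  {a | ∀ i ∈ ι ⁻¹' a.1, ∀ j ∈ ι ⁻¹' a.1, (t i j).2 ∧ (t i j).1 ⊆ a.1}

theorem fiber_inter_closedUnderTrace (f : M → M → Pk κ lam) :
    fiber κ ι r d ∩ closedUnderTrace κ ι (trace r d f) = fiber κ ι r d ∩ closedUnder ι f := by
  ext a
  refine and_congr_right fun h => ⟨fun ht => ⟨h.1.1, fun i hi j hj => ?_⟩,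
    fun hf i hi j hj => ⟨(hf.2 i hi j hj).trans (subset_preimage_Iio_of_mem_fiber h),
      Set.inter_subset_left.trans (hf.2 i hi j hj)⟩⟩
  obtain ⟨hall, hsub⟩ := ht i hi j hj
  exact (Set.subset_inter subset_rfl hall).trans hsub

theorem mk_preimage_Iic_le_mk_traces (hκ : κ.IsRegular) {k : M} (hk : k < d) :
    #(r ⁻¹' Set.Iic k) ≤ #(traces κ r d) := by
  have hsingleton : ∀ x : r ⁻¹' Set.Iic k, {x.1} ∩ r ⁻¹' Set.Iio d = {x.1} := fun x =>
    Set.inter_eq_left.2 (Set.singleton_subset_iff.2 (lt_of_le_of_lt x.2 hk))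
  refine mk_le_of_injective
    (f := fun x => ⟨trace r d fun _ _ => singletonPk hκ x.1, Set.mem_range_self _⟩)
    fun x y hxy => ?_
  have heq : {x.1} ∩ r ⁻¹' Set.Iio d = {y.1} ∩ r ⁻¹' Set.Iio d :=
    congrArg (fun t => (t.1 k k).1) hxy
  rw [hsingleton, hsingleton] at heq
  exact Subtype.ext (Set.singleton_injective heq)

/-- The possible values of the part of a family of functions `f d : M → M → Pk κ lam`, for `d` in
`M`, that lives on `{x | r x ≤ k}`. -/
def Truncation (κ : Cardinal.{u}) (r : lam.ord.ToType → M) (k : M) : Type u :=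
  M → M → M → {s : Set (r ⁻¹' Set.Iic k) // #s < κ} × Prop

/-- The part of a family of functions that lives on `{x | r x ≤ k}`, together with the information
which values are contained in `{x | r x < d}`. -/
def truncation (r : lam.ord.ToType → M) (f : M → M → M → Pk κ lam) (k : M) : Truncation κ r k :=
  fun d i j => (⟨Subtype.val ⁻¹' (f d i j).1,
    (mk_preimage_of_injective _ _ Subtype.val_injective).trans_lt (f d i j).2⟩,
    (f d i j).1 ⊆ r ⁻¹' Set.Iio d)

theorem trace_eq_of_truncation_eq (h : a ∈ fiber κ ι r d) {f g : M → M → M → Pk κ lam}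
    (hfg : ∀ k ∈ ι ⁻¹' a.1, truncation r f k = truncation r g k) :
    trace r d (f d) = trace r d (g d) := by
  funext i j
  have hval : ∀ k ∈ ι ⁻¹' a.1, truncation r f k d i j = truncation r g k d i j := fun k hk => by
    rw [hfg k hk]
  have hmem : ∀ x, r x < d → (x ∈ (f d i j).1 ↔ x ∈ (g d i j).1) := fun x hx => by
    obtain ⟨k, hk, hle⟩ := exists_le_of_mem_fiber h hx
    exact Set.ext_iff.1 (congrArg (fun p => p.1.1) (hval k hk)) ⟨x, hle⟩
  obtain ⟨k, hk⟩ := h.1.1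
  exact Prod.ext (Set.ext fun x => and_congr_left (hmem x)) (congrArg (fun p => p.2) (hval k hk))

end Trace

section Guessing

variable {κ lam : Cardinal.{u}} {M : Type u} [LinearOrder M] {ι : M ↪ lam.ord.ToType}
  {r : lam.ord.ToType → M} {code : (Σ k, Truncation κ r k) ↪ lam.ord.ToType} {a : Pk κ lam} {d : M}

/-- The traces at `d` of the families of functions whose truncations at the elements of `M` in `a`
all have their codes in `a`. -/
def guessed (ι : M ↪ lam.ord.ToType) (code : (Σ k, Truncation κ r k) ↪ lam.ord.ToType)
    (d : M) (a : Pk κ lam) : Set (M → M → Set lam.ord.ToType × Prop) :=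
  {t | ∃ f : M → M → M → Pk κ lam,
    (∀ k ∈ ι ⁻¹' a.1, code ⟨k, truncation r f k⟩ ∈ a.1) ∧ trace r d (f d) = t}

theorem mk_guessed_le (h : a ∈ fiber κ ι r d) : #(guessed ι code d a) ≤ 2 ^ #a.1 := by
  choose f hcode htrace using fun t : guessed ι code d a => t.2
  rw [← mk_set]
  refine mk_le_of_injective
    (f := fun t => {z : a.1 | ∃ k ∈ ι ⁻¹' a.1, code ⟨k, truncation r (f t) k⟩ = z})
    fun t t' ht => ?_
  refine Subtype.ext ?_
  rw [← htrace t, ← htrace t']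
  refine trace_eq_of_truncation_eq h fun k hk => ?_
  obtain ⟨k', -, hk'⟩ := (Set.ext_iff.1 ht ⟨_, hcode t k hk⟩).1 ⟨k, hk, rfl⟩
  obtain ⟨rfl, heq⟩ := Sigma.mk.inj (code.injective hk')
  exact (eq_of_heq heq).symm

theorem two_power_mk_lt_mk_traces (hκ : κ.IsRegular) (hbig : ∀ k, 2 ^ #M < #(r ⁻¹' Set.Iic k))
    {k : M} (hk : k < d) : 2 ^ #M < #(traces κ r d) :=
  (hbig k).trans_le (mk_preimage_Iic_le_mk_traces hκ hk)

theorem infinite_traces [Infinite M] (hκ : κ.IsRegular)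
    (hbig : ∀ k, 2 ^ #M < #(r ⁻¹' Set.Iic k)) {k : M} (hk : k < d) : Infinite (traces κ r d) :=
  infinite_iff.2 (((aleph0_le_mk M).trans (cantor _).le).trans
    (two_power_mk_lt_mk_traces hκ hbig hk).le)

theorem exists_unguessed [Infinite M] (hκ : κ.IsRegular) (hcof : κ ≤ Order.cof M)
    (hbig : ∀ k, 2 ^ #M < #(r ⁻¹' Set.Iic k)) {W : Set (Pk κ lam)}
    (hW : #(W ∩ fiber κ ι r d : Set (Pk κ lam)) < #(traces κ r d)) :
    ∃ f : M → M → Pk κ lam, ∀ a ∈ W ∩ fiber κ ι r d, trace r d f ∉ guessed ι code d a := by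
  suffices hlt : #(⋃ a ∈ W ∩ fiber κ ι r d, guessed ι code d a) < #(traces κ r d) by
    obtain ⟨_, ⟨f, rfl⟩, hf⟩ := Set.not_subset.1 fun h => (mk_le_mk_of_subset h).not_gt hlt
    exact ⟨f, fun a ha hfa => hf (Set.mem_biUnion ha hfa)⟩
  obtain hempty | ⟨a, ha⟩ := (W ∩ fiber κ ι r d).eq_empty_or_nonempty
  · simpa only [hempty, Set.biUnion_empty, mk_eq_zero] using pos_of_gt hW
  obtain ⟨k, hk⟩ := exists_lt_of_mem_fiber ha.2
  have : Infinite (traces κ r d) := infinite_traces hκ hbig hk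
  calc #(⋃ a ∈ W ∩ fiber κ ι r d, guessed ι code d a)
      ≤ #(W ∩ fiber κ ι r d : Set (Pk κ lam)) *
          ⨆ a : (W ∩ fiber κ ι r d : Set (Pk κ lam)), #(guessed ι code d a.1) :=
        mk_biUnion_le _ _
    _ ≤ #(W ∩ fiber κ ι r d : Set (Pk κ lam)) * 2 ^ #M := by
        refine mul_le_mul_right (ciSup_le' fun b => (mk_guessed_le b.2.2).trans ?_) _
        exact power_le_power_left two_ne_zero
          (b.1.2.le.trans (hcof.trans (Order.cof_le_cardinalMk M)))
    _ < #(traces κ r d) :=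
        mul_lt_of_lt (aleph0_le_mk _) hW (two_power_mk_lt_mk_traces hκ hbig hk)

theorem exists_mk_traces_le_mk_inter_fiber [WellFoundedLT M] [Infinite M] (hκ : κ.IsRegular)
    (hcof : κ ≤ Order.cof M) (hbig : ∀ k, 2 ^ #M < #(r ⁻¹' Set.Iic k))
    (code : (Σ k, Truncation κ r k) ↪ lam.ord.ToType) {W : Set (Pk κ lam)}
    (hW : W ∩ dominating κ ι r ∉ closureIdeal κ ι) :
    ∃ d, #(traces κ r d) ≤ #(W ∩ fiber κ ι r d : Set (Pk κ lam)) := by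
  by_contra! hlt
  choose f hf using fun d => exists_unguessed (code := code) hκ hcof hbig (hlt d)
  refine hW ⟨fun k _ => singletonPk hκ (code ⟨k, truncation r f k⟩),
    Set.disjoint_left.2 fun a ha hclosed => ?_⟩
  obtain ⟨d, had⟩ := exists_mem_fiber hcof ha.2
  exact hf d a ⟨ha.1, had⟩ ⟨f, fun k hk => hclosed.2 k hk k hk rfl, rfl⟩

theorem isThickBase_restrict_dominating [WellFoundedLT M] [Infinite M] (hκ : κ.IsRegular)
    (hcof : κ ≤ Order.cof M) (hbig : ∀ k, 2 ^ #M < #(r ⁻¹' Set.Iic k))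
    (code : (Σ k, Truncation κ r k) ↪ lam.ord.ToType) :
    IsThickBase (restrict (closureIdeal κ ι) (dominating κ ι r))
      fun (d : {d : M // ∃ k, k < d}) (t : traces κ r d) =>
        fiber κ ι r d ∩ closedUnderTrace κ ι t.1 where
  disjoint hne _ _ := (disjoint_fiber (Subtype.coe_ne_coe.2 hne)).mono
    Set.inter_subset_left Set.inter_subset_left
  exists_thick := by
    rintro W hW A ⟨f, hf⟩
    have hWf : W ∩ closedUnder ι f ∩ dominating κ ι r ∉ closureIdeal κ ι := by
      rw [Set.inter_right_comm]
      exact inter_closedUnder_notMem hκ hW f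
    obtain ⟨d, hd⟩ := exists_mk_traces_le_mk_inter_fiber hκ hcof hbig code hWf
    obtain ⟨⟨a, ha⟩⟩ := mk_ne_zero_iff.1
      ((pos_iff_ne_zero.2 (mk_ne_zero_iff.2 ⟨trace r d f, f, rfl⟩)).trans_le hd).ne'
    refine ⟨⟨d, exists_lt_of_mem_fiber ha.2⟩, ⟨trace r d f, f, rfl⟩, ?_, ?_⟩
    · rw [fiber_inter_closedUnderTrace]
      exact Set.disjoint_left.2 fun b hb hbA => Set.disjoint_left.1 hf ⟨hbA, hb.1.1⟩ hb.2
    · rwa [fiber_inter_closedUnderTrace, Set.inter_comm (fiber κ ι r d), ← Set.inter_assoc]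

end Guessing

section Coding

variable {κ lam : Cardinal.{u}} {M : Type u} [LinearOrder M] [Infinite M]
  {r : lam.ord.ToType → M}

theorem mk_truncation_le (hκM : κ ≤ #M) (k : M) :
    #(Truncation κ r k) ≤ max #(r ⁻¹' Set.Iic k) ℵ₀ ^ #M := by
  set τ := max #(r ⁻¹' Set.Iic k) ℵ₀
  have hsmall : #{s : Set (r ⁻¹' Set.Iic k) // #s < κ} ≤ τ ^ #M :=
    (mk_subtype_mono (p := fun s : Set (r ⁻¹' Set.Iic k) => #s < κ)
      fun _ hs => hs.le.trans hκM).trans (mk_bounded_set_le _ _)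
  have hτ : ℵ₀ ≤ τ ^ #M :=
    (le_max_right _ _).trans (self_le_power _ (one_le_aleph0.trans (aleph0_le_mk M)))
  calc #(Truncation κ r k)
      = (((#{s : Set (r ⁻¹' Set.Iic k) // #s < κ} * 2) ^ #M) ^ #M) ^ #M := by simp [Truncation]
    _ ≤ (((τ ^ #M) ^ #M) ^ #M) ^ #M := by
        refine power_le_power_right (power_le_power_right (power_le_power_right ?_))
        exact (mul_le_mul' hsmall ((natCast_le_aleph0 (n := 2)).trans hτ)).trans (mul_eq_self hτ).le
    _ = τ ^ #M := by simp only [← power_mul, mul_eq_self (aleph0_le_mk M)]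

theorem exists_truncation_code (hκM : κ ≤ #M) (hlam : ℵ₀ < lam)
    (hpow : ∀ τ < lam, τ ^ #M < lam) (hsmall : ∀ k, #(r ⁻¹' Set.Iic k) < lam) :
    Nonempty ((Σ k, Truncation κ r k) ↪ lam.ord.ToType) := by
  have hM : #M ≤ lam := (cantor _).le.trans (hpow 2 (natCast_lt_aleph0.trans hlam)).le
  change #(Σ k, Truncation κ r k) ≤ #lam.ord.ToType
  calc #(Σ k, Truncation κ r k) = sum fun k => #(Truncation κ r k) := mk_sigma _
    _ ≤ sum fun _ : M => lam := sum_le_sum _ _ fun k =>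
        (mk_truncation_le hκM k).trans (hpow _ (max_lt (hsmall k) hlam)).le
    _ = #M * lam := sum_const' _ _
    _ ≤ lam := (mul_le_max_of_aleph0_le_right hlam.le).trans (max_le hM le_rfl)
    _ = #lam.ord.ToType := (mk_ord_toType lam).symm

end Coding

section Rank

theorem exists_monotone_isCofinal_range (o : Ordinal.{u}) :
    ∃ g : o.cof.ord.ToType → o.ToType, Monotone g ∧ IsCofinal (Set.range g) := by
  obtain ⟨s, hs, htype⟩ := Ordinal.exists_ord_cof_eq o.ToType
  rw [Ordinal.cof_toType, ← Ordinal.type_toType o.cof.ord, eq_comm, Ordinal.type_eq] at htype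
  obtain ⟨e⟩ := htype
  refine ⟨fun k => e k, fun _ _ h => (OrderIso.ofRelIsoLT e).monotone h, fun x => ?_⟩
  obtain ⟨z, hz, hxz⟩ := hs x
  exact ⟨z, ⟨e.symm ⟨z, hz⟩, by simp⟩, hxz⟩

theorem exists_mk_Iio_eq {c lam : Cardinal.{u}} (h : c < lam) :
    ∃ y : lam.ord.ToType, #(Set.Iio y) = c := by
  obtain ⟨y, hy⟩ := Ordinal.mem_range_typein_iff (α := lam.ord.ToType) (· < ·) |>.2
    (show c.ord < _ by rw [Ordinal.type_toType]; exact ord_lt_ord.2 h)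
  exact ⟨y, by rw [← card_ord c, ← hy]; rfl⟩

theorem exists_rank_to_cof {lam ν : Cardinal.{u}} (hlam : ℵ₀ ≤ lam) (hν : Order.succ ν < lam) :
    ∃ r : lam.ord.ToType → lam.ord.cof.ord.ToType,
      ∀ k, ν < #(r ⁻¹' Set.Iic k) ∧ #(r ⁻¹' Set.Iic k) < lam := by
  obtain ⟨g, hg, hcofinal⟩ := exists_monotone_isCofinal_range lam.ord
  obtain ⟨y, hy⟩ := exists_mk_Iio_eq hν
  have hne : ∀ x, {k | x ≤ max (g k) y}.Nonempty := fun x =>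
    let ⟨_, ⟨k, hk⟩, hxk⟩ := hcofinal x
    ⟨k, le_max_of_le_left (hk ▸ hxk)⟩
  let r : lam.ord.ToType → lam.ord.cof.ord.ToType := fun x => wellFounded_lt.min _ (hne x)
  have hlower : ∀ k, Set.Iio y ⊆ r ⁻¹' Set.Iic k := fun k x hx =>
    wellFounded_lt.min_le (s := {k | x ≤ max (g k) y})
      (show x ≤ max (g k) y from le_max_of_le_right (le_of_lt hx))
  have hupper : ∀ k, r ⁻¹' Set.Iic k ⊆ Set.Iic (max (g k) y) := fun k x hx =>
    (wellFounded_lt.min_mem _ (hne x)).trans (max_le_max_right y (hg hx))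
  refine ⟨r, fun k => ⟨?_, ?_⟩⟩
  · exact (Order.lt_succ ν).trans_le (hy.ge.trans (mk_le_mk_of_subset (hlower k)))
  · have hlt : #(Set.Iic (max (g k) y)) < #lam.ord.ToType :=
      mk_Iic_lt _ (by simp) (by rwa [mk_ord_toType])
    exact (mk_le_mk_of_subset (hupper k)).trans_lt (hlt.trans_eq (mk_ord_toType lam))

end Rank

theorem exists_embedding_range_iff {lam μ : Cardinal.{u}} (h : μ ≤ lam) :
    ∃ ι : μ.ord.ToType ↪ lam.ord.ToType, ∀ x, toOrd x < μ.ord ↔ x ∈ Set.range ι := by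
  let ι : μ.ord.ToType → lam.ord.ToType := fun i =>
    Ordinal.ToType.mk ⟨toOrd i, show toOrd i < lam.ord from
      lt_of_lt_of_le (Ordinal.ToType.mk.symm i).2 (ord_le_ord.2 h)⟩
  have hι : ∀ i, toOrd (ι i) = toOrd i := fun i => by simp [ι, toOrd]
  refine ⟨⟨ι, fun i j hij => ?_⟩, fun x => ⟨fun hx => ?_, ?_⟩⟩
  · exact Ordinal.ToType.mk.symm.injective (Subtype.ext ((hι i).symm.trans (hij ▸ hι j)))
  · exact ⟨Ordinal.ToType.mk ⟨toOrd x, hx⟩, by simp [ι, toOrd]⟩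
  · rintro ⟨i, rfl⟩
    exact (hι i).trans_lt (Ordinal.ToType.mk.symm i).2

end PKappa

theorem proposition3p1 (κ lam : Cardinal.{u}) (hκ : κ.IsRegular) (hκ_unc : Cardinal.aleph0 < κ)
    (hlam : lam.IsSingular) (hcof : κ ≤ lam.ord.cof)
    (hpow : ∀ τ < lam, τ ^ lam.ord.cof < lam) :
    ∃ B ∈ PKappa.dualFilter (PKappa.NS κ lam),
      PKappa.NowherePrecipitous
        (PKappa.restrict (PKappa.NSmu κ lam lam.ord.cof) B) := by
  have hinf : ℵ₀ ≤ lam.ord.cof := hκ_unc.le.trans hcof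
  have hM : #lam.ord.cof.ord.ToType = lam.ord.cof := mk_ord_toType _
  have hcofM : κ ≤ Order.cof lam.ord.cof.ord.ToType := by
    rwa [Ordinal.cof_toType, Ordinal.cof_ord_cof]
  have : NoMaxOrder lam.ord.cof.ord.ToType := Cardinal.noMaxOrder hinf
  have : Infinite lam.ord.cof.ord.ToType := infinite_iff.2 (hM.symm ▸ hinf)
  obtain ⟨ι, hι⟩ := PKappa.exists_embedding_range_iff hlam.cof_ord_lt.le
  obtain ⟨r, hr⟩ := PKappa.exists_rank_to_cof hlam.aleph0_le
    (hlam.isSuccLimit.succ_lt (hpow 2 (hlam.natCast_lt 2)))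
  have hbig : ∀ k, 2 ^ #lam.ord.cof.ord.ToType < #(r ⁻¹' Set.Iic k) := fun k => by
    rw [hM]; exact (hr k).1
  obtain ⟨code⟩ := PKappa.exists_truncation_code (κ := κ) (r := r) (hcof.trans_eq hM.symm)
    (hinf.trans_lt hlam.cof_ord_lt) (by rwa [hM]) fun k => (hr k).2
  refine ⟨PKappa.dominating κ ι r, PKappa.dominating_mem_dualFilter hκ hκ_unc, ?_⟩
  rw [PKappa.NSmu_eq_closureIdeal hκ hκ_unc hι]
  have (d : {d : lam.ord.cof.ord.ToType // ∃ k, k < d}) : Infinite (PKappa.traces κ r d) :=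
    PKappa.infinite_traces hκ hbig d.2.choose_spec
  exact ((PKappa.isIdeal_closureIdeal hκ hκ_unc).restrict
    (PKappa.dominating_notMem_closureIdeal hκ hκ_unc)).nowherePrecipitous
    (PKappa.isThickBase_restrict_dominating hκ hcofM hbig code)
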